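/- Let $X$ be a locally compact Hausdorff space and let $A$ be a $*$-subalgebra of the algebra $C(X)$ of continuous complex-valued functions on $X$ (with pointwise operations and $a^+(x)=\overline{a(x)}$) which contains the constant function $1$ and separates the points of $X$. Let $\mu$ be a positive regular Borel measure on $X$ such that $A\subseteq L^1(X,\mu)$, and let $\eta,\xi\in L^\infty(X,\mu)$ be nonnegative. Define positive linear functionals $f_\eta$ and $f_\xi$ on $A$ by $$f_\eta(a)=\int_X a(x)\eta(x)\,d\mu(x),\qquad f_\xi(a)=\int_X a(x)\xi(x)\,d\mu(x)\qquad (a\in A).$$ Suppose that the GNS representations $\pi_{f_\eta}$ and $\pi_{f_\xi}$ are essentially self-adjoint. Then $$P_A(f_\eta,f_\xi)=\Big(\int_X \eta(x)^{1/2}\,\xi(x)^{1/2}\,d\mu(x)\Big)^2 .$$ Here a $*$-representation $\pi$ of $A$ is an algebra homomorphism of $A$ into the linear operators on a dense linear subspace $D(\pi)$ of a Hilbert space such that $\pi(1)=I$ and $\langle\pi(a)\varphi,\psi\rangle=\langle\varphi,\pi(a^+)\psi\rangle$ for all $a\in A$ and $\varphi,\psi\in D(\pi)$. Its adjoint $\pi^*$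 has the domain $D(\pi^*)=\bigcap_{a\in A}D(\pi(a)^*)$ and acts by $\pi^*(a)=\pi(a^+)^*|_{D(\pi^*)}$; the biadjoint $\pi^{**}$ has the domain $D(\pi^{**})=\bigcap_{a\in A}D(\pi^*(a)^*)$ and acts by $\pi^{**}(a)=\pi^*(a^+)^*|_{D(\pi^{**})}$; and $\pi$ is called essentially self-adjoint if $\pi^*=\pi^{**}$. The GNS representation $\pi_f$ of a positive linear functional $f$ is the (up to unitary equivalence unique) $*$-representation that has a vector $\varphi_f$ with $D(\pi_f)=\pi_f(A)\varphi_f$ and $f(a)=\langle\pi_f(a)\varphi_f,\varphi_f\rangle$ for all $a\in A$. The transition probability $P_A(f,g)$ of positive linear functionals $f,g$ on $A$ is the supremum of $|\langle\varphi,\psi\rangle|^2$ over all $*$-representations $\pi$ of $A$ and all $\varphi,\psi\in D(\pi)$ such that $f(a)=\langle\pi(a)\varphi,\varphi\rangle$ and $g(a)=\langle\pi(a)\psi,\psi\rangle$ for all $a\in A$. -/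

import Mathlib

/-! Unbounded `*`-representations of complex unital `*`-algebras, the GNS representation of a
positive linear functional, and the transition probability of two positive functionals.
Inner products are linear in the second variable (Mathlib's convention), so that `⟨x, y⟩` of a
text with inner products linear in the first variable is `inner ℂ y x` here. -/

universe u v

noncomputable section

namespace UnboundedRep

section Representations

variable {A : Type u} [Ring A] [StarRing A] [Algebra ℂ A]
variable {H : Type v} [NormedAddCommGroup H] [InnerProductSpace ℂ H]

/-- A `*`-representation of the unital `*`-algebra `A` on a dense linear subspace `domain` of the
Hilbert space `H`: a unital algebra homomorphism of `A` into the algebra of all linear operators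
`domain → domain` such that `⟨π(a)φ, ψ⟩ = ⟨φ, π(a⁺)ψ⟩` on `domain`. (The operators `π(a)` are then
closable, because their adjoints are densely defined.) -/
structure StarRep (A : Type u) [Ring A] [StarRing A] [Algebra ℂ A]
    (H : Type v) [NormedAddCommGroup H] [InnerProductSpace ℂ H] where
  /-- the domain `D(π)` -/
  domain : Submodule ℂ H
  dense_domain : Dense (domain : Set H)
  /-- the operators `π(a) : D(π) → D(π)` -/
  op : A →ₐ[ℂ] Module.End ℂ domain
  inner_op : ∀ (a : A) (φ ψ : domain),
    inner ℂ (op a φ : H) (ψ : H) = inner ℂ (φ : H) (op (star a) ψ : H)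

/-- The operators `π(a)` of a `*`-representation as densely defined operators on `H`. -/
def StarRep.toFamily (π : StarRep A H) (a : A) : H →ₗ.[ℂ] H :=
  ⟨π.domain, π.domain.subtype ∘ₗ π.op a⟩

variable [CompleteSpace H]

/-- The adjoint of a family `ρ(a)`, `a ∈ A`, of densely defined operators on `H`: its domain is
`D(ρ*) = ⋂ a, D(ρ(a)*)`, and `ρ*(a)` is the restriction of `ρ(a⁺)*` to `D(ρ*)`. -/
def adjointFamily (ρ : A → H →ₗ.[ℂ] H) (a : A) : H →ₗ.[ℂ] H :=
  (ρ (star a)).adjoint.domRestrict (⨅ b : A, (ρ b).adjoint.domain)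

/-- The adjoint representation `π*` of a `*`-representation `π`. -/
def StarRep.adjointRep (π : StarRep A H) : A → H →ₗ.[ℂ] H := adjointFamily π.toFamily

/-- The biadjoint `π**` of a `*`-representation `π`. -/
def StarRep.biadjointRep (π : StarRep A H) : A → H →ₗ.[ℂ] H := adjointFamily π.adjointRep

/-- `π` is essentially self-adjoint if its adjoint is self-adjoint, `π* = π**` (equality of
operators, including their domains). -/
def StarRep.IsEssentiallySelfAdjoint (π : StarRep A H) : Prop :=
  π.adjointRep = π.biadjointRep

end Representations

section Functionals

open scoped ComplexOrder

/-- A positive linear functional on a complex `*`-algebra: a linear functional `f` with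
`f(a⁺a) ≥ 0` for all `a`. -/
structure PositiveFunctional (A : Type u) [Ring A] [StarRing A] [Algebra ℂ A]
    extends A →ₗ[ℂ] ℂ where
  nonneg' : ∀ a : A, 0 ≤ toFun (star a * a)

variable {A : Type u} [Ring A] [StarRing A] [Algebra ℂ A]

instance : CoeFun (PositiveFunctional A) (fun _ => A → ℂ) := ⟨fun f => f.toLinearMap⟩

theorem PositiveFunctional.nonneg (f : PositiveFunctional A) (a : A) : 0 ≤ f (star a * a) :=
  f.nonneg' a

theorem PositiveFunctional.map_star [StarModule ℂ A] (f : PositiveFunctional A) (a : A) :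
    f (star a) = star (f a) := by
  have h0 := (Complex.nonneg_iff.1 (f.nonneg a)).2
  have h1 := (Complex.nonneg_iff.1 (f.nonneg 1)).2
  have h2 := (Complex.nonneg_iff.1 (f.nonneg (a + 1))).2
  have h3 := (Complex.nonneg_iff.1 (f.nonneg (Complex.I • a + 1))).2
  simp only [star_one, mul_one] at h1
  simp only [star_add, star_one, add_mul, mul_add, mul_one, one_mul, map_add,
    Complex.add_im] at h2
  simp only [star_add, star_one, star_smul, add_mul, mul_add, mul_one, one_mul, map_add,
    map_smul, smul_mul_assoc, mul_smul_comm, smul_eq_mul, Complex.add_im,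
    Complex.mul_im, Complex.mul_re, Complex.star_def, Complex.conj_I, Complex.neg_re,
    Complex.neg_im, Complex.I_re, Complex.I_im] at h3
  apply Complex.ext
  · rw [Complex.star_def, Complex.conj_re]
    linarith
  · rw [Complex.star_def, Complex.conj_im]
    linarith

/-- The set of all numbers `|⟨φ, ψ⟩|²`, where `φ` and `ψ` are vectors in the domain of a common
`*`-representation `π` of `A` on a Hilbert space (in the universe `v`) such that
`f(a) = ⟨π(a)φ, φ⟩` and `g(a) = ⟨π(a)ψ, ψ⟩` for all `a ∈ A`. -/
def transitionValues (f g : PositiveFunctional A) : Set ℝ :=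
  {r | ∃ (H : Type v) (_ : NormedAddCommGroup H) (_ : InnerProductSpace ℂ H)
      (_ : CompleteSpace H) (π : StarRep A H) (φ ψ : π.domain),
      (∀ a : A, f a = inner ℂ (φ : H) (π.op a φ : H)) ∧
      (∀ a : A, g a = inner ℂ (ψ : H) (π.op a ψ : H)) ∧
      r = ‖inner ℂ (ψ : H) (φ : H)‖ ^ 2}

/-- The transition probability `P_A(f, g)`: the supremum of all `|⟨φ, ψ⟩|²` over the
realizations of `f` and `g` as vector functionals in a common `*`-representation. -/
def transitionProb (f g : PositiveFunctional A) : ℝ :=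
  sSup (transitionValues.{u, v} f g)

end Functionals

section GNS

variable {A : Type u} [Ring A] [StarRing A] [Algebra ℂ A]

/-- The vector space `A`, carrying the semi-inner product `⟨a, b⟩ ↦ f(b⁺a)`. -/
@[nolint unusedArguments]
def PreGNS (_f : PositiveFunctional A) : Type u := A

namespace PreGNS

variable (f : PositiveFunctional A)

instance : AddCommGroup (PreGNS f) := inferInstanceAs (AddCommGroup A)
instance : Module ℂ (PreGNS f) := inferInstanceAs (Module ℂ A)

/-- The identity map. -/
def of : A ≃ₗ[ℂ] PreGNS f := LinearEquiv.refl ℂ A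

variable [StarModule ℂ A]

/-- The semi-inner product of `a` and `b` is `f(a⁺b)` (linear in `b`). -/
abbrev core : PreInnerProductSpace.Core ℂ (PreGNS f) where
  inner a b := f (star ((of f).symm a) * (of f).symm b)
  conj_inner_symm a b := by
    have h := f.map_star (star ((of f).symm b) * (of f).symm a)
    rw [star_mul, star_star] at h
    rw [h]
    rfl
  re_inner_nonneg a := (Complex.nonneg_iff.1 (f.nonneg ((of f).symm a))).1
  add_left a b c := by rw [map_add, star_add, add_mul, map_add]
  smul_left a b r := by
    rw [map_smul, star_smul, smul_mul_assoc, map_smul]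
    rfl

instance : SeminormedAddCommGroup (PreGNS f) :=
  InnerProductSpace.Core.toSeminormedAddCommGroup (c := core f)
instance : InnerProductSpace ℂ (PreGNS f) := InnerProductSpace.ofCore (core f)

theorem inner_of (a b : A) : inner ℂ (of f a) (of f b) = f (star a * b) := rfl

end PreGNS

variable [StarModule ℂ A] (f : PositiveFunctional A)

/-- The Hilbert space of the GNS representation of `f`: the Hausdorff completion of `A` with
respect to the semi-inner product given by `f`. -/
abbrev GNSSpace : Type u := UniformSpace.Completion (PreGNS f)

/-- The canonical map `A → GNSSpace f`, `a ↦ π_f(a)φ_f`. -/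
def gnsVec : A →ₗ[ℂ] GNSSpace f :=
  (UniformSpace.Completion.toComplₗᵢ (𝕜 := ℂ) (E := PreGNS f)).toLinearMap ∘ₗ
    (PreGNS.of f).toLinearMap

theorem inner_gnsVec (a b : A) : inner ℂ (gnsVec f a) (gnsVec f b) = f (star a * b) :=
  (UniformSpace.Completion.inner_coe (𝕜 := ℂ) (PreGNS.of f a) (PreGNS.of f b)).trans
    (PreGNS.inner_of f a b)

theorem ker_gnsVec_le (a : A) :
    LinearMap.ker (gnsVec f) ≤ (LinearMap.ker (gnsVec f)).comap (LinearMap.mulLeft ℂ a) := by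
  intro b hb
  rw [LinearMap.mem_ker] at hb
  rw [Submodule.mem_comap, LinearMap.mem_ker, LinearMap.mulLeft_apply,
    ← inner_self_eq_zero (𝕜 := ℂ), inner_gnsVec, star_mul, mul_assoc, ← inner_gnsVec, hb,
    inner_zero_left]

/-- The operator `π_f(a)` on the range of `gnsVec f`, induced by `b ↦ a * b`. -/
def gnsOp (a : A) : Module.End ℂ (LinearMap.range (gnsVec f)) :=
  (gnsVec f).quotKerEquivRange.toLinearMap ∘ₗ
    (Submodule.mapQ _ _ (LinearMap.mulLeft ℂ a) (ker_gnsVec_le f a)) ∘ₗ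
    (gnsVec f).quotKerEquivRange.symm.toLinearMap

theorem gnsOp_gnsVec (a b : A) :
    gnsOp f a ⟨gnsVec f b, LinearMap.mem_range_self _ b⟩ =
      ⟨gnsVec f (a * b), LinearMap.mem_range_self _ (a * b)⟩ := by
  have h : (gnsVec f).quotKerEquivRange.symm ⟨gnsVec f b, LinearMap.mem_range_self _ b⟩ =
      Submodule.Quotient.mk b := by
    rw [LinearEquiv.symm_apply_eq]
    rfl
  simp only [gnsOp, LinearMap.comp_apply, LinearEquiv.coe_coe, h]
  rfl

/-- The GNS representation `π_f` of a positive linear functional `f`: left multiplication,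
acting on the image of `A` in its completion. -/
def gnsRep : StarRep A (GNSSpace f) where
  domain := LinearMap.range (gnsVec f)
  dense_domain := by
    have h : ((LinearMap.range (gnsVec f) : Submodule ℂ (GNSSpace f)) : Set (GNSSpace f)) =
        Set.range (fun x : PreGNS f => (x : GNSSpace f)) := by
      ext y
      constructor
      · rintro ⟨b, rfl⟩
        exact ⟨PreGNS.of f b, rfl⟩
      · rintro ⟨b, rfl⟩
        exact ⟨(PreGNS.of f).symm b, rfl⟩
    rw [h]
    exact UniformSpace.Completion.denseRange_coe
  op := AlgHom.ofLinearMap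
    { toFun := gnsOp f
      map_add' := by
        rintro a b
        ext ⟨_, c, rfl⟩
        rw [LinearMap.add_apply]
        simp only [gnsOp_gnsVec, add_mul, map_add, Submodule.coe_add]
      map_smul' := by
        rintro r a
        ext ⟨_, c, rfl⟩
        rw [LinearMap.smul_apply]
        simp only [gnsOp_gnsVec, smul_mul_assoc, map_smul, Submodule.coe_smul, RingHom.id_apply] }
    (by
      ext ⟨_, c, rfl⟩
      simp only [LinearMap.coe_mk, AddHom.coe_mk, gnsOp_gnsVec, one_mul, Module.End.one_apply])
    (by
      intro a b
      ext ⟨_, c, rfl⟩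
      simp only [LinearMap.coe_mk, AddHom.coe_mk, gnsOp_gnsVec, mul_assoc, Module.End.mul_apply])
  inner_op := by
    rintro a ⟨_, b, rfl⟩ ⟨_, c, rfl⟩
    simp only [AlgHom.ofLinearMap_apply, LinearMap.coe_mk, AddHom.coe_mk, gnsOp_gnsVec,
      inner_gnsVec, star_mul, mul_assoc]

end GNS

section Integrals

open MeasureTheory
open scoped ComplexOrder ENNReal

theorem integrable_mul_weight {X : Type u} [MeasurableSpace X] {μ : Measure X} {a : X → ℂ} {η : X → ℝ} (ha : Integrable a μ)
    (hη : MemLp η ∞ μ) : Integrable (fun x => a x * (η x : ℂ)) μ := by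
  have h : MemLp (fun x => (η x : ℂ)) ∞ μ := hη.ofReal
  have h2 : Integrable ((fun x => (η x : ℂ)) * a) μ :=
    memLp_one_iff_integrable.1 ((memLp_one_iff_integrable.2 ha).mul h)
  exact h2.congr (Filter.Eventually.of_forall fun x => mul_comm _ _)

variable {X : Type u} [TopologicalSpace X] [MeasurableSpace X] [BorelSpace X]

/-- The positive linear functional `a ↦ ∫ a(x) η(x) dμ(x)` on a unital `*`-subalgebra `A` of
`C(X)` with `A ⊆ L¹(X, μ)`, for a nonnegative function `η ∈ L^∞(X, μ)`. -/
def integralFunctional (A : StarSubalgebra ℂ C(X, ℂ)) (μ : Measure X)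
    (hA : ∀ a ∈ A, Integrable (fun x => a x) μ) (η : X → ℝ) (hη : MemLp η ∞ μ)
    (hη0 : 0 ≤ᵐ[μ] η) : PositiveFunctional A where
  toFun a := ∫ x, (a : C(X, ℂ)) x * (η x : ℂ) ∂μ
  map_add' a b := by
    rw [← integral_add (integrable_mul_weight (hA _ a.2) hη)
      (integrable_mul_weight (hA _ b.2) hη)]
    exact integral_congr_ae (Filter.Eventually.of_forall fun x => add_mul _ _ _)
  map_smul' r a := by
    rw [RingHom.id_apply, smul_eq_mul, ← integral_const_mul]
    exact integral_congr_ae (Filter.Eventually.of_forall fun x => mul_assoc _ _ _)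
  nonneg' a := by
    have h : ∫ x, ((star a * a : A) : C(X, ℂ)) x * (η x : ℂ) ∂μ =
        ∫ x, ((‖(a : C(X, ℂ)) x‖ ^ 2 * η x : ℝ) : ℂ) ∂μ := by
      refine integral_congr_ae (Filter.Eventually.of_forall fun x => ?_)
      have : ((star a * a : A) : C(X, ℂ)) x = star ((a : C(X, ℂ)) x) * (a : C(X, ℂ)) x := rfl
      simp only [this, Complex.star_def, Complex.conj_mul', Complex.ofReal_mul,
        Complex.ofReal_pow]
    change 0 ≤ ∫ x, ((star a * a : A) : C(X, ℂ)) x * (η x : ℂ) ∂μ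
    rw [h, integral_complex_ofReal]
    refine Complex.zero_le_real.2 (integral_nonneg_of_ae ?_)
    filter_upwards [hη0] with x hx
    exact mul_nonneg (sq_nonneg _) hx

end Integrals

end UnboundedRep

end

/-! The transition probability is attained at the vectors `√η` and `√ξ` of the representation of
`A` on `L²(X, μ)` by multiplication operators, with the domain of all `h` such that `a h ∈ L²` for
every `a ∈ A`; the measure `μ` is finite because `1 ∈ A` is integrable. These two vectors realize
`f_η` and `f_ξ`, and their inner product is `∫ √η √ξ dμ`.

For the upper bound, let `φ` and `ψ` realize `f_η` and `f_ξ` in some `*`-representation `π`.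
Comparing the cyclic subspaces of `φ` and `ψ` with those of `√η` and `√ξ` through the GNS spaces
produces a contraction `S` on `L²(X, μ)` with `⟨√ξ, S √η⟩ = ⟨ψ, φ⟩`. Essential self-adjointness
enters here only: it says that the adjoints of the two GNS representations are symmetric
(`StarRep.IsEssentiallySelfAdjoint.inner_adjoint_comm`), and applying this twice shows that `S`
lies in the weak commutant of the multiplication representation
(`exists_contraction_weakCommutant`).

The domain of the multiplication representation is invariant under the bounded functions
`1 / (1 + |a|²)`, so `S` commutes with multiplication by them (`commute_mulOp_of_weakCommutant`).
As they separate the points of `X`, Stone-Weierstrass on compact sets and the regularity of `μ`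
give `⟨q, S p⟩ = ∫ q p (S 1) dμ` for bounded `p` and `q` (`inner_boundedVec_apply`). The right-hand
side depends on the product `q p` only, so for `p, q ≥ 0` and `w = √(q p)`
`|⟨q, S p⟩| = |⟨w, S w⟩| ≤ ‖w‖² = ∫ q p dμ`,
which for `p = √η` and `q = √ξ` is the required bound. -/

open MeasureTheory
open scoped ComplexOrder ENNReal InnerProductSpace

universe w

noncomputable section

namespace UnboundedRep

/-! ### Essentially self-adjoint representations -/

section Adjoint

variable {A : Type u} [Ring A] [StarRing A] [Algebra ℂ A]
variable {H : Type v} [NormedAddCommGroup H] [InnerProductSpace ℂ H] [CompleteSpace H]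

theorem StarRep.mem_adjointRep_domain (π : StarRep A H) {x : H} {x' : A → H}
    (hx : ∀ (a : A) (z : π.domain), ⟪x' a, (z : H)⟫_ℂ = ⟪x, (π.op a z : H)⟫_ℂ) (a : A) :
    x ∈ (π.adjointRep a).domain := by
  have h : ∀ b, x ∈ (π.toFamily b).adjoint.domain := fun b =>
    LinearPMap.mem_adjoint_domain_of_exists _ ⟨x' b, fun z => hx b z⟩
  exact ⟨Submodule.mem_iInf _ |>.2 h, h _⟩

theorem StarRep.adjointRep_apply (π : StarRep A H) {x : H} {x' : A → H}
    (hx : ∀ (a : A) (z : π.domain), ⟪x' a, (z : H)⟫_ℂ = ⟪x, (π.op a z : H)⟫_ℂ) (a : A)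
    (h : x ∈ (π.adjointRep a).domain) : π.adjointRep a ⟨x, h⟩ = x' (star a) := by
  have h' : x ∈ (π.toFamily (star a)).adjoint.domain := h.2
  have h1 : π.adjointRep a ⟨x, h⟩ = (π.toFamily (star a)).adjoint ⟨x, h'⟩ :=
    LinearPMap.domRestrict_apply rfl
  rw [h1]
  exact LinearPMap.adjoint_apply_eq π.dense_domain _ fun z => hx _ z

theorem StarRep.dense_adjointRep_domain (π : StarRep A H) (a : A) :
    Dense ((π.adjointRep a).domain : Set H) := by
  refine π.dense_domain.mono fun x hx => ?_
  refine π.mem_adjointRep_domain (x' := fun a => π.op (star a) ⟨x, hx⟩) (fun b z => ?_) a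
  rw [π.inner_op, star_star]

/-- The adjoint of an essentially self-adjoint representation is symmetric. Vectors `x`, `y` of
`D(π*)` are given together with the values `x' a = π(a)* x` and `y' a = π(a)* y`. -/
theorem StarRep.IsEssentiallySelfAdjoint.inner_adjoint_comm {π : StarRep A H}
    (hπ : π.IsEssentiallySelfAdjoint) {x y : H} {x' y' : A → H}
    (hx : ∀ (a : A) (z : π.domain), ⟪x' a, (z : H)⟫_ℂ = ⟪x, (π.op a z : H)⟫_ℂ)
    (hy : ∀ (a : A) (z : π.domain), ⟪y' a, (z : H)⟫_ℂ = ⟪y, (π.op a z : H)⟫_ℂ) (a : A) :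
    ⟪x' a, y⟫_ℂ = ⟪x, y' (star a)⟫_ℂ := by
  have hle := le_of_eq (congrFun hπ a)
  have hxd := π.mem_adjointRep_domain hx (star a)
  have hyd := π.mem_adjointRep_domain hy a
  have hyb : y ∈ (π.biadjointRep a).domain := hle.1 hyd
  have hyb' : y ∈ (π.adjointRep (star a)).adjoint.domain := hyb.2
  have h1 : π.biadjointRep a ⟨y, hyb⟩ = (π.adjointRep (star a)).adjoint ⟨y, hyb'⟩ :=
    LinearPMap.domRestrict_apply rfl
  have h2 : π.adjointRep a ⟨y, hyd⟩ = π.biadjointRep a ⟨y, hyb⟩ := hle.2 rfl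
  rw [π.adjointRep_apply hy, h1] at h2
  have h3 := LinearPMap.adjoint_isFormalAdjoint (π.dense_adjointRep_domain (star a))
    ⟨y, hyb'⟩ ⟨x, hxd⟩
  rw [π.adjointRep_apply hx, ← h2, star_star] at h3
  rw [← inner_conj_symm, ← h3, inner_conj_symm]

end Adjoint

/-! ### Maps between GNS spaces -/

section GNSMaps

variable {A : Type u} [Ring A] [StarRing A] [Algebra ℂ A] [StarModule ℂ A]
variable {E : Type w} [NormedAddCommGroup E] [InnerProductSpace ℂ E] [CompleteSpace E]

/-- A linear map `L` on `A` with `⟨L a, L b⟩ = f(a⁺b)` extends to an isometry of the GNS space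
of `f`. -/
theorem exists_gns_linearIsometry (f : PositiveFunctional A) (L : A →ₗ[ℂ] E)
    (hL : ∀ a b, ⟪L a, L b⟫_ℂ = f (star a * b)) :
    ∃ V : GNSSpace f →ₗᵢ[ℂ] E, ∀ a, V (gnsVec f a) = L a := by
  let L0 : PreGNS f →ₗ[ℂ] E := L ∘ₗ (PreGNS.of f).symm.toLinearMap
  have hnorm : ∀ x, ‖L0 x‖ = ‖x‖ := fun x => by
    rw [@norm_eq_sqrt_re_inner ℂ, @norm_eq_sqrt_re_inner ℂ (PreGNS f)]
    congr 2
    exact hL _ _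
  let L1 : PreGNS f →ₗᵢ[ℂ] E := ⟨L0, hnorm⟩
  let V := L1.toContinuousLinearMap.fromCompletion
  have hV : ∀ x : PreGNS f, V (x : GNSSpace f) = L0 x := fun x =>
    ContinuousLinearMap.fromCompletion_apply_coe _ x
  refine ⟨⟨V.toLinearMap, fun x => ?_⟩, fun a => hV _⟩
  induction x using UniformSpace.Completion.induction_on with
  | hp => exact isClosed_eq V.continuous.norm continuous_norm
  | ih x =>
    change ‖V x‖ = _
    rw [hV, hnorm, UniformSpace.Completion.norm_coe]

theorem mem_gnsRep_domain (f : PositiveFunctional A) (a : A) :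
    gnsVec f a ∈ (gnsRep f).domain :=
  LinearMap.mem_range_self _ a

theorem gnsRep_op_gnsVec (f : PositiveFunctional A) (a b : A) :
    (gnsRep f).op a ⟨gnsVec f b, mem_gnsRep_domain f b⟩ =
      ⟨gnsVec f (a * b), mem_gnsRep_domain f (a * b)⟩ :=
  gnsOp_gnsVec f a b

/-- Symmetry of `π_f*` for an essentially self-adjoint GNS representation `π_f`, where membership
in `D(π_f*)` is tested on the vectors `gnsVec f b` only. -/
theorem inner_gnsVec_adjoint_comm {f : PositiveFunctional A}
    (hf : (gnsRep f).IsEssentiallySelfAdjoint) {x y : GNSSpace f} {x' y' : A → GNSSpace f}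
    (hx : ∀ a b, ⟪x' a, gnsVec f b⟫_ℂ = ⟪x, gnsVec f (a * b)⟫_ℂ)
    (hy : ∀ a b, ⟪y' a, gnsVec f b⟫_ℂ = ⟪y, gnsVec f (a * b)⟫_ℂ) (a : A) :
    ⟪x' a, y⟫_ℂ = ⟪x, y' (star a)⟫_ℂ := by
  refine hf.inner_adjoint_comm ?_ ?_ a
  · rintro a ⟨_, b, rfl⟩
    exact (hx a b).trans (by rw [gnsRep_op_gnsVec])
  · rintro a ⟨_, b, rfl⟩
    exact (hy a b).trans (by rw [gnsRep_op_gnsVec])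

/-- A bounded operator `T` that intertwines two essentially self-adjoint GNS representations on
the vectors `gnsVec` also intertwines their adjoint representations. The values `π_f(a)* x` and
`π_g(a)* y` are given as `x' a` and `y' a`. -/
theorem inner_intertwiner_adjoint {f g : PositiveFunctional A}
    (hf : (gnsRep f).IsEssentiallySelfAdjoint) (hg : (gnsRep g).IsEssentiallySelfAdjoint)
    (T : GNSSpace f →L[ℂ] GNSSpace g)
    (hT : ∀ a b c, ⟪T (gnsVec f (c * a)), gnsVec g b⟫_ℂ =
      ⟪T (gnsVec f a), gnsVec g (star c * b)⟫_ℂ)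
    {x : GNSSpace f} {y : GNSSpace g} {x' : A → GNSSpace f} {y' : A → GNSSpace g}
    (hx : ∀ a b, ⟪x' a, gnsVec f b⟫_ℂ = ⟪x, gnsVec f (a * b)⟫_ℂ)
    (hy : ∀ a b, ⟪y' a, gnsVec g b⟫_ℂ = ⟪y, gnsVec g (a * b)⟫_ℂ) (a : A) :
    ⟪T (x' a), y⟫_ℂ = ⟪T x, y' (star a)⟫_ℂ := by
  -- `T` maps `D(π_f*)` into `D(π_g*)`: test against `gnsVec g b` and move `T` to the other side.
  refine inner_gnsVec_adjoint_comm hg (x' := fun a => T (x' a)) (fun a b => ?_) hy a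
  rw [← ContinuousLinearMap.adjoint_inner_right, ← ContinuousLinearMap.adjoint_inner_right T x]
  have h := inner_gnsVec_adjoint_comm hf hx
    (y := ContinuousLinearMap.adjoint T (gnsVec g b))
    (y' := fun a => ContinuousLinearMap.adjoint T (gnsVec g (star a * b)))
    (fun a c => by
      rw [ContinuousLinearMap.adjoint_inner_left, ContinuousLinearMap.adjoint_inner_left,
        ← inner_conj_symm, ← hT, inner_conj_symm]) a
  rwa [star_star] at h

/-- A vector `χ` in the domain of a `*`-representation induces an isometry of the GNS space of
its vector functional onto the closed cyclic subspace generated by `χ`. -/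
theorem StarRep.exists_gns_linearIsometry (π : StarRep A E) (f : PositiveFunctional A)
    (χ : π.domain) (hχ : ∀ a, f a = ⟪(χ : E), (π.op a χ : E)⟫_ℂ) :
    ∃ V : GNSSpace f →ₗᵢ[ℂ] E, ∀ a, V (gnsVec f a) = π.op a χ :=
  UnboundedRep.exists_gns_linearIsometry f
    (π.domain.subtype ∘ₗ (LinearMap.applyₗ χ) ∘ₗ π.op.toLinearMap) fun a b => by
      change ⟪(π.op a χ : E), (π.op b χ : E)⟫_ℂ = _
      rw [π.inner_op, hχ, map_mul]
      rfl

/-- For the isometry `V` of the GNS space onto the closed cyclic subspace of `χ`, the map `V*`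
sends `D(ρ)` into the domain of `π_f*`, with `π_f(a)* V* h = V* ρ(a⁺) h`. -/
theorem StarRep.inner_adjoint_gnsVec (ρ : StarRep A E) {f : PositiveFunctional A} {χ : ρ.domain}
    {V : GNSSpace f →ₗᵢ[ℂ] E} (hV : ∀ a, V (gnsVec f a) = ρ.op a χ) (h : ρ.domain) (a b : A) :
    ⟪ContinuousLinearMap.adjoint V.toContinuousLinearMap (ρ.op (star a) h : E),
      gnsVec f b⟫_ℂ =
    ⟪ContinuousLinearMap.adjoint V.toContinuousLinearMap (h : E), gnsVec f (a * b)⟫_ℂ := by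
  rw [ContinuousLinearMap.adjoint_inner_left, ContinuousLinearMap.adjoint_inner_left]
  simp only [LinearIsometry.coe_toContinuousLinearMap, hV, map_mul]
  rw [ρ.inner_op, star_star]
  rfl

/-- If `f` and `g` have essentially self-adjoint GNS representations and are realized as vector
functionals in two `*`-representations `π` and `ρ`, then the inner product of the vectors in `π`
is a matrix element, at the vectors in `ρ`, of a contraction in the weak commutant of `ρ`. -/
theorem exists_contraction_weakCommutant {F : Type v} [NormedAddCommGroup F]
    [InnerProductSpace ℂ F] [CompleteSpace F] {f g : PositiveFunctional A}
    (hf : (gnsRep f).IsEssentiallySelfAdjoint) (hg : (gnsRep g).IsEssentiallySelfAdjoint)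
    (π : StarRep A E) (φ ψ : π.domain) (hφ : ∀ a, f a = ⟪(φ : E), (π.op a φ : E)⟫_ℂ)
    (hψ : ∀ a, g a = ⟪(ψ : E), (π.op a ψ : E)⟫_ℂ)
    (ρ : StarRep A F) (φ' ψ' : ρ.domain) (hφ' : ∀ a, f a = ⟪(φ' : F), (ρ.op a φ' : F)⟫_ℂ)
    (hψ' : ∀ a, g a = ⟪(ψ' : F), (ρ.op a ψ' : F)⟫_ℂ) :
    ∃ S : F →L[ℂ] F, ‖S‖ ≤ 1 ∧
      (∀ (a : A) (h k : ρ.domain),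
        ⟪S (ρ.op (star a) h : F), (k : F)⟫_ℂ = ⟪S (h : F), (ρ.op a k : F)⟫_ℂ) ∧
      ⟪(ψ' : F), S (φ' : F)⟫_ℂ = ⟪(ψ : E), (φ : E)⟫_ℂ := by
  obtain ⟨V, hV⟩ := π.exists_gns_linearIsometry f φ hφ
  obtain ⟨W, hW⟩ := π.exists_gns_linearIsometry g ψ hψ
  obtain ⟨V', hV'⟩ := ρ.exists_gns_linearIsometry f φ' hφ'
  obtain ⟨W', hW'⟩ := ρ.exists_gns_linearIsometry g ψ' hψ'
  set T : GNSSpace f →L[ℂ] GNSSpace g :=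
    ContinuousLinearMap.adjoint W.toContinuousLinearMap ∘L V.toContinuousLinearMap with hTdef
  have hT1 : ‖T‖ ≤ 1 := by
    refine (ContinuousLinearMap.opNorm_comp_le _ _).trans ?_
    rw [LinearIsometryEquiv.norm_map]
    exact mul_le_one₀ W.norm_toContinuousLinearMap_le (norm_nonneg _)
      V.norm_toContinuousLinearMap_le
  have hT : ∀ a b c, ⟪T (gnsVec f (c * a)), gnsVec g b⟫_ℂ =
      ⟪T (gnsVec f a), gnsVec g (star c * b)⟫_ℂ := fun a b c => by
    rw [hTdef, ContinuousLinearMap.comp_apply, ContinuousLinearMap.adjoint_inner_left,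
      ContinuousLinearMap.comp_apply, ContinuousLinearMap.adjoint_inner_left]
    simp only [LinearIsometry.coe_toContinuousLinearMap, hV, hW, map_mul]
    exact π.inner_op c _ _
  refine ⟨W'.toContinuousLinearMap ∘L T ∘L
    ContinuousLinearMap.adjoint V'.toContinuousLinearMap, ?_, fun a h k => ?_, ?_⟩
  · refine (ContinuousLinearMap.opNorm_comp_le _ _).trans
      (mul_le_one₀ W'.norm_toContinuousLinearMap_le (norm_nonneg _) ?_)
    refine (ContinuousLinearMap.opNorm_comp_le _ _).trans (mul_le_one₀ hT1 (norm_nonneg _) ?_)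
    rw [LinearIsometryEquiv.norm_map]
    exact V'.norm_toContinuousLinearMap_le
  · have h1 := inner_intertwiner_adjoint hf hg T hT
      (x' := fun a => ContinuousLinearMap.adjoint V'.toContinuousLinearMap
        (ρ.op (star a) h : F))
      (y' := fun a => ContinuousLinearMap.adjoint W'.toContinuousLinearMap
        (ρ.op (star a) k : F))
      (ρ.inner_adjoint_gnsVec hV' h) (ρ.inner_adjoint_gnsVec hW' k) a
    rw [star_star, ContinuousLinearMap.adjoint_inner_right,
      ContinuousLinearMap.adjoint_inner_right] at h1
    exact h1
  · have hV1 : (φ' : F) = V' (gnsVec f 1) := by rw [hV', map_one, Module.End.one_apply]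
    have hW1 : (ψ' : F) = W' (gnsVec g 1) := by rw [hW', map_one, Module.End.one_apply]
    have hVV : ContinuousLinearMap.adjoint V'.toContinuousLinearMap (φ' : F) = gnsVec f 1 := by
      refine ext_inner_right ℂ fun z => ?_
      rw [ContinuousLinearMap.adjoint_inner_left, hV1]
      exact V'.inner_map_map _ _
    rw [ContinuousLinearMap.comp_apply, ContinuousLinearMap.comp_apply, hVV, hW1]
    refine (W'.inner_map_map _ _).trans ?_
    rw [hTdef, ContinuousLinearMap.comp_apply, ContinuousLinearMap.adjoint_inner_right]
    simp only [LinearIsometry.coe_toContinuousLinearMap, hV, hW, map_one, Module.End.one_apply]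

end GNSMaps

/-! ### Density of subalgebras of bounded functions -/

section Density

variable {X : Type*} [TopologicalSpace X]

/-- Stone-Weierstrass on a compact set, with a bound on the whole space: an approximation coming
from the subalgebra is truncated by composing it with a polynomial that is close to the clipping
function `t ↦ max (-C) (min t C)`. -/
theorem exists_mem_subalgebra_near_of_bounded {R : Subalgebra ℝ C(X, ℝ)}
    (hbdd : ∀ u ∈ R, ∃ C : ℝ, ∀ x, |u x| ≤ C) (hsep : R.SeparatesPoints) (f : C(X, ℝ)) {C : ℝ}
    (hf : ∀ x, |f x| ≤ C) {K : Set X} (hK : IsCompact K) {ε : ℝ} (hε : 0 < ε) :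
    ∃ u ∈ R, (∀ x ∈ K, |u x - f x| ≤ ε) ∧ ∀ x, |u x| ≤ C + ε := by
  obtain ⟨g, hg, hgf⟩ :=
    ContinuousMap.exists_mem_subalgebra_near_continuous_of_isCompact_of_separatesPoints
      hsep f hK (half_pos hε)
  obtain ⟨M, hM⟩ := hbdd g hg
  let c : ℝ → ℝ := fun t => max (-C) (min t C)
  obtain ⟨p, hp⟩ := exists_polynomial_near_of_continuousOn (-M) M c
    (by fun_prop) (ε / 2) (half_pos hε)
  have hval : ∀ x, (Polynomial.aeval g p) x = p.eval (g x) := fun x => by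
    have := Polynomial.aeval_algHom_apply (ContinuousMap.evalAlgHom ℝ ℝ x) g p
    rw [Polynomial.coe_aeval_eq_eval] at this
    exact this.symm
  have hclip : ∀ x, |p.eval (g x) - c (g x)| < ε / 2 := fun x => hp _ (abs_le.1 (hM x))
  refine ⟨Polynomial.aeval g p,
    Algebra.adjoin_singleton_le hg (Polynomial.aeval_mem_adjoin_singleton ℝ g), fun x hx => ?_, fun x => ?_⟩
  · have h1 := hclip x
    have h2 := hgf x hx
    rw [Real.norm_eq_abs] at h2
    have h3 : |c (g x) - f x| ≤ |g x - f x| := by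
      have hfx : f x = c (f x) := by
        have := abs_le.1 (hf x)
        simp [c, this.1, this.2]
      rw [show |c (g x) - f x| = |c (g x) - c (f x)| by rw [← hfx]]
      refine (abs_max_sub_max_le_max _ _ _ _).trans ?_
      rw [sub_self, abs_zero, max_eq_right (abs_nonneg _)]
      refine (abs_min_sub_min_le_max _ _ _ _).trans ?_
      rw [sub_self, abs_zero, max_eq_left (abs_nonneg _)]
    rw [hval]
    have := abs_sub_le (p.eval (g x)) (c (g x)) (f x)
    linarith
  · have hC : 0 ≤ C := (abs_nonneg _).trans (hf x)
    have h1 := hclip x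
    have h3 : |c (g x)| ≤ C := by
      refine abs_le.2 ⟨le_max_left _ _, max_le (by linarith) (min_le_right _ _)⟩
    rw [hval]
    have h4 : |p.eval (g x)| ≤ |p.eval (g x) - c (g x)| + |c (g x)| := by
      simpa using abs_add_le (p.eval (g x) - c (g x)) (c (g x))
    linarith

theorem exists_pos_setIntegral_norm_le_of_measure_lt {Y : Type*} [MeasurableSpace Y]
    {ν : Measure Y} {v : Y → ℂ} (hv : Integrable v ν) {ε : ℝ} (hε : 0 < ε) :
    ∃ δ > 0, ∀ s, ν s < δ → ∫ x in s, ‖v x‖ ∂ν ≤ ε := by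
  obtain ⟨δ, hδ, hδs⟩ := exists_pos_setLIntegral_lt_of_measure_lt (μ := ν)
    (f := fun x => ‖v x‖ₑ) hv.2.ne (ENNReal.ofReal_pos.2 hε).ne'
  refine ⟨δ, hδ, fun s hs => ?_⟩
  rw [integral_norm_eq_lintegral_enorm hv.1.restrict]
  exact ENNReal.toReal_le_of_le_ofReal hε.le (hδs s hs).le

variable [T2Space X] [MeasurableSpace X] [BorelSpace X]
  {μ : Measure X} [μ.Regular] [IsFiniteMeasure μ]

theorem integral_mul_eq_zero_of_forall_mem_subalgebra {R : Subalgebra ℝ C(X, ℝ)}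
    (hbdd : ∀ u ∈ R, ∃ C : ℝ, ∀ x, |u x| ≤ C) (hsep : R.SeparatesPoints) {v : X → ℂ}
    (hv : Integrable v μ) (h : ∀ u ∈ R, ∫ x, (u x : ℂ) * v x ∂μ = 0) (f : C(X, ℝ)) {C : ℝ}
    (hf : ∀ x, |f x| ≤ C) : ∫ x, (f x : ℂ) * v x ∂μ = 0 := by
  have hint : ∀ (u : C(X, ℝ)) (D : ℝ), (∀ x, |u x| ≤ D) →
      Integrable (fun x => (u x : ℂ) * v x) μ := fun u D hu =>
    hv.bdd_mul (c := D) (by fun_prop) (Filter.Eventually.of_forall fun x => by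
      simpa using hu x)
  rcases isEmpty_or_nonempty X with hX | ⟨⟨x0⟩⟩
  · simp [Measure.eq_zero_of_isEmpty μ]
  have hC : 0 ≤ C := (abs_nonneg _).trans (hf x0)
  set N := ∫ x, ‖v x‖ ∂μ
  have hN : 0 ≤ N := integral_nonneg fun _ => norm_nonneg _
  -- On a compact set carrying almost all of `|v| dμ` the function `f` is approximated uniformly,
  -- and off this set the boundedness of the approximation suffices.
  have key : ∀ ε : ℝ, 0 < ε → ε ≤ 1 → ‖∫ x, (f x : ℂ) * v x ∂μ‖ ≤ ε * (N + (2 * C + 1)) := by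
    intro ε hε hε1
    obtain ⟨δ, hδ, hδs⟩ := exists_pos_setIntegral_norm_le_of_measure_lt hv hε
    obtain ⟨K, -, hK, hKδ⟩ := MeasurableSet.univ.exists_isCompact_sdiff_lt (μ := μ)
      (measure_ne_top _ _) hδ.ne'
    rw [← Set.compl_eq_univ_sdiff] at hKδ
    have hKv : ∫ x in Kᶜ, ‖v x‖ ∂μ ≤ ε := hδs _ hKδ
    obtain ⟨u, hu, huK, huC⟩ := exists_mem_subalgebra_near_of_bounded hbdd hsep f hf hK hε
    have h1 : ∫ x, (f x : ℂ) * v x ∂μ = ∫ x, ((f x : ℂ) * v x - (u x : ℂ) * v x) ∂μ := by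
      rw [integral_sub (hint f C hf) (hint u _ huC), h u hu, sub_zero]
    have hbound : ∀ x, ‖(f x : ℂ) * v x - (u x : ℂ) * v x‖ ≤
        ε * ‖v x‖ + (2 * C + 1) * (Kᶜ).indicator (fun x => ‖v x‖) x := by
      intro x
      rw [← sub_mul, norm_mul, ← Complex.ofReal_sub, Complex.norm_real, Real.norm_eq_abs]
      by_cases hx : x ∈ K
      · rw [Set.indicator_of_notMem (by simpa using hx), mul_zero, add_zero, abs_sub_comm]
        exact mul_le_mul_of_nonneg_right (huK x hx) (norm_nonneg _)
      · rw [Set.indicator_of_mem (by simpa using hx)]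
        have h2 : |f x - u x| ≤ 2 * C + 1 := by
          have := abs_sub (f x) (u x)
          linarith [hf x, huC x]
        nlinarith [mul_le_mul_of_nonneg_right h2 (norm_nonneg (v x)), norm_nonneg (v x)]
    have hKm : MeasurableSet Kᶜ := hK.measurableSet.compl
    have hind : Integrable ((Kᶜ).indicator (fun x => ‖v x‖)) μ := hv.norm.indicator hKm
    rw [h1]
    refine (norm_integral_le_of_norm_le
      ((hv.norm.const_mul ε).add (hind.const_mul (2 * C + 1)))
      (Filter.Eventually.of_forall hbound)).trans ?_
    rw [integral_add' (hv.norm.const_mul ε) (hind.const_mul (2 * C + 1)), integral_const_mul,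
      integral_const_mul, integral_indicator hKm]
    have : 0 ≤ 2 * C + 1 := by linarith
    nlinarith [mul_le_mul_of_nonneg_left hKv this]
  by_contra hne
  set I := ‖∫ x, (f x : ℂ) * v x ∂μ‖
  have hI : 0 < I := norm_pos_iff.2 hne
  set B := N + (2 * C + 1)
  have hB : 0 < B := by positivity
  have h1 := key (min 1 (I / (2 * B))) (by positivity) (min_le_left _ _)
  have h2 : min 1 (I / (2 * B)) * B ≤ I / (2 * B) * B :=
    mul_le_mul_of_nonneg_right (min_le_right _ _) hB.le
  have h3 : I / (2 * B) * B = I / 2 := by field_simp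
  linarith

variable [LocallyCompactSpace X]

/-- Bounded continuous functions determine integrals over compact sets by outer regularity, and
these determine integrals over all measurable sets by inner regularity. -/
theorem ae_eq_zero_of_forall_integral_continuous_mul_eq_zero {v : X → ℂ} (hv : Integrable v μ)
    (h : ∀ f : C(X, ℝ), (∀ x, |f x| ≤ 1) → ∫ x, (f x : ℂ) * v x ∂μ = 0) : v =ᵐ[μ] 0 := by
  have hK : ∀ K : Set X, IsCompact K → ∫ x in K, v x ∂μ = 0 := by
    intro K hK
    refine norm_le_zero_iff.1 (le_of_forall_pos_le_add fun ε hε => ?_)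
    rw [zero_add]
    obtain ⟨δ, hδ, hδs⟩ := exists_pos_setIntegral_norm_le_of_measure_lt hv hε
    obtain ⟨U, hKU, hU, -, hUδ⟩ := hK.measurableSet.exists_isOpen_sdiff_lt
      (measure_ne_top μ K) hδ.ne'
    obtain ⟨f, hf1, hf0, -, hf⟩ := exists_continuous_one_zero_of_isCompact hK
      hU.isClosed_compl (Set.disjoint_compl_right_iff_subset.2 hKU)
    have hf' : ∀ x, |f x| ≤ 1 := fun x => abs_le.2 ⟨by linarith [(hf x).1], (hf x).2⟩
    have hint : Integrable (fun x => (f x : ℂ) * v x) μ :=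
      hv.bdd_mul (c := 1) (by fun_prop) (Filter.Eventually.of_forall fun x => by
        simpa using hf' x)
    have hm : MeasurableSet (U \ K) := hU.measurableSet.diff hK.measurableSet
    have h1 : ∫ x in K, v x ∂μ =
        ∫ x, (K.indicator v x - (f x : ℂ) * v x) ∂μ := by
      rw [integral_sub (hv.indicator hK.measurableSet) hint, h f hf', sub_zero,
        integral_indicator hK.measurableSet]
    rw [h1]
    refine (norm_integral_le_of_norm_le (hv.norm.indicator hm)
      (Filter.Eventually.of_forall fun x => ?_)).trans
      ((integral_indicator hm).trans_le (hδs _ hUδ))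
    by_cases hxK : x ∈ K
    · simp [hxK, hf1 hxK]
    · by_cases hxU : x ∈ U
      · simp only [hxK, not_false_eq_true, Set.indicator_of_notMem, zero_sub, norm_neg,
          norm_mul, Complex.norm_real, Real.norm_eq_abs]
        rw [Set.indicator_of_mem (by exact ⟨hxU, hxK⟩)]
        exact mul_le_of_le_one_left (norm_nonneg _) (hf' x)
      · simp [hxK, hxU, hf0 hxU]
  refine ae_eq_zero_of_forall_setIntegral_eq_of_sigmaFinite (fun _ _ _ => hv.integrableOn)
    fun s hs _ => ?_
  refine norm_le_zero_iff.1 (le_of_forall_pos_le_add fun ε hε => ?_)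
  rw [zero_add]
  obtain ⟨δ, hδ, hδs⟩ := exists_pos_setIntegral_norm_le_of_measure_lt hv hε
  obtain ⟨K, hKs, hKc, hKδ⟩ := hs.exists_isCompact_sdiff_lt (measure_ne_top μ s) hδ.ne'
  have h1 := setIntegral_sdiff hKc.measurableSet hv.integrableOn hKs
  rw [hK K hKc, sub_zero] at h1
  rw [← h1]
  exact (norm_integral_le_integral_norm _).trans (hδs _ hKδ)

/-- A subalgebra of bounded continuous real functions that separates the points has trivial
annihilator in `L¹` of a finite regular measure. -/
theorem ae_eq_zero_of_forall_mem_subalgebra {R : Subalgebra ℝ C(X, ℝ)}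
    (hbdd : ∀ u ∈ R, ∃ C : ℝ, ∀ x, |u x| ≤ C) (hsep : R.SeparatesPoints) {v : X → ℂ}
    (hv : Integrable v μ) (h : ∀ u ∈ R, ∫ x, (u x : ℂ) * v x ∂μ = 0) : v =ᵐ[μ] 0 :=
  ae_eq_zero_of_forall_integral_continuous_mul_eq_zero hv fun f hf =>
    integral_mul_eq_zero_of_forall_mem_subalgebra hbdd hsep hv h f hf

end Density

/-! ### Operators on `L²` that commute with multiplications -/

section Multiplication

variable {X : Type*} [MeasurableSpace X] {μ : Measure X}

/-- Multiplication by an essentially bounded function as an operator on `L²`. -/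
def mulOp {u : X → ℂ} (hu : MemLp u ∞ μ) : Lp ℂ 2 μ →L[ℂ] Lp ℂ 2 μ :=
  (ContinuousLinearMap.mul ℂ ℂ).holderL μ ∞ 2 2 hu.toLp

theorem coeFn_mulOp {u : X → ℂ} (hu : MemLp u ∞ μ) (h : Lp ℂ 2 μ) :
    mulOp hu h =ᵐ[μ] fun x => u x * h x := by
  have h1 : mulOp hu h =ᵐ[μ] fun x => hu.toLp u x * h x :=
    (ContinuousLinearMap.mul ℂ ℂ).coeFn_holder _ _
  filter_upwards [h1, hu.coeFn_toLp] with x h1 h2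
  rw [h1, h2]

theorem mulOp_add {u v : X → ℂ} (hu : MemLp u ∞ μ) (hv : MemLp v ∞ μ)
    (huv : MemLp (fun x => u x + v x) ∞ μ) : mulOp huv = mulOp hu + mulOp hv := by
  ext1 h
  refine Lp.ext ?_
  filter_upwards [coeFn_mulOp hu h, coeFn_mulOp hv h, coeFn_mulOp huv h,
    Lp.coeFn_add (mulOp hu h) (mulOp hv h)] with x h1 h2 h3 h4
  rw [add_apply, h4, Pi.add_apply, h1, h2, h3, add_mul]

theorem mulOp_mul {u v : X → ℂ} (hu : MemLp u ∞ μ) (hv : MemLp v ∞ μ)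
    (huv : MemLp (fun x => u x * v x) ∞ μ) : mulOp huv = mulOp hu * mulOp hv := by
  ext1 h
  refine Lp.ext ?_
  filter_upwards [coeFn_mulOp hu (mulOp hv h), coeFn_mulOp hv h, coeFn_mulOp huv h]
    with x h1 h2 h3
  rw [mul_apply_eq_comp, h1, h2, h3, mul_assoc]

theorem mulOp_const (c : ℂ) (hc : MemLp (fun _ : X => c) ∞ μ) : mulOp hc = c • 1 := by
  ext1 h
  refine Lp.ext ?_
  filter_upwards [coeFn_mulOp hc h, Lp.coeFn_smul c h] with x h1 h2
  rw [smul_apply, one_apply_eq_self, h1, h2]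
  rfl

theorem memLp_top_ofReal_of_bound [TopologicalSpace X] [BorelSpace X] (u : C(X, ℝ))
    {C : ℝ} (hC : ∀ x, |u x| ≤ C) : MemLp (fun x => (u x : ℂ)) ∞ μ := by
  have hu : MemLp u ∞ μ := memLp_top_of_bound u.continuous.measurable.aestronglyMeasurable C
    (Filter.Eventually.of_forall hC)
  exact hu.ofReal

/-- The bounded continuous real functions whose multiplication operators commute with `S`. -/
def commutingSubalgebra [TopologicalSpace X] [BorelSpace X] (S : Lp ℂ 2 μ →L[ℂ] Lp ℂ 2 μ) :
    Subalgebra ℝ C(X, ℝ) where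
  carrier := {u | (∃ C : ℝ, ∀ x, |u x| ≤ C) ∧
    ∃ hu : MemLp (fun x => (u x : ℂ)) ∞ μ, Commute S (mulOp hu)}
  mul_mem' := by
    rintro u v ⟨⟨C, hC⟩, hu, hSu⟩ ⟨⟨D, hD⟩, hv, hSv⟩
    have huv : ∀ x, |(u * v) x| ≤ C * D := fun x => by
      rw [ContinuousMap.mul_apply, abs_mul]
      exact mul_le_mul (hC x) (hD x) (abs_nonneg _) ((abs_nonneg _).trans (hC x))
    have h : MemLp (fun x => (u x : ℂ) * (v x : ℂ)) ∞ μ := by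
      simpa using memLp_top_ofReal_of_bound (μ := μ) _ huv
    refine ⟨⟨_, huv⟩, memLp_top_ofReal_of_bound _ huv, ?_⟩
    have h1 := mulOp_mul hu hv h
    simp only [ContinuousMap.mul_apply, Complex.ofReal_mul]
    rw [h1]
    exact hSu.mul_right hSv
  add_mem' := by
    rintro u v ⟨⟨C, hC⟩, hu, hSu⟩ ⟨⟨D, hD⟩, hv, hSv⟩
    have huv : ∀ x, |(u + v) x| ≤ C + D := fun x =>
      (abs_add_le _ _).trans (add_le_add (hC x) (hD x))
    have h : MemLp (fun x => (u x : ℂ) + (v x : ℂ)) ∞ μ := by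
      simpa using memLp_top_ofReal_of_bound (μ := μ) _ huv
    refine ⟨⟨_, huv⟩, memLp_top_ofReal_of_bound _ huv, ?_⟩
    have h1 := mulOp_add hu hv h
    simp only [ContinuousMap.add_apply, Complex.ofReal_add]
    rw [h1]
    exact hSu.add_right hSv
  algebraMap_mem' r := by
    have hr : ∀ x : X, |(algebraMap ℝ C(X, ℝ) r) x| ≤ |r| := fun x => le_of_eq (by simp)
    refine ⟨⟨_, hr⟩, memLp_top_ofReal_of_bound _ hr, ?_⟩
    have h : mulOp (memLp_top_ofReal_of_bound (μ := μ) _ hr) = (r : ℂ) • 1 := by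
      have := mulOp_const (μ := μ) (X := X) (r : ℂ) (memLp_top_const _)
      rw [← this]
      congr 1
    rw [h]
    exact (Commute.one_right S).smul_right _

/-- The class in `L²` of an essentially bounded real function. -/
def boundedVec [IsFiniteMeasure μ] {p : X → ℝ} (hp : MemLp p ∞ μ) : Lp ℂ 2 μ :=
  MemLp.toLp (fun x => (p x : ℂ)) (hp.ofReal.mono_exponent le_top)

theorem coeFn_boundedVec [IsFiniteMeasure μ] {p : X → ℝ} (hp : MemLp p ∞ μ) :
    boundedVec hp =ᵐ[μ] fun x => (p x : ℂ) :=
  MemLp.coeFn_toLp _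

theorem inner_boundedVec [IsFiniteMeasure μ] {p : X → ℝ} (hp : MemLp p ∞ μ) (h : Lp ℂ 2 μ) :
    ⟪boundedVec hp, h⟫_ℂ = ∫ x, (p x : ℂ) * h x ∂μ := by
  rw [L2.inner_def]
  refine integral_congr_ae ?_
  filter_upwards [coeFn_boundedVec hp] with x hx
  rw [hx, RCLike.inner_apply, Complex.conj_ofReal, mul_comm]

theorem inner_boundedVec_boundedVec [IsFiniteMeasure μ] {p q : X → ℝ} (hp : MemLp p ∞ μ)
    (hq : MemLp q ∞ μ) : ⟪boundedVec hp, boundedVec hq⟫_ℂ = (∫ x, p x * q x ∂μ : ℝ) := by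
  rw [inner_boundedVec, ← integral_complex_ofReal]
  refine integral_congr_ae ?_
  filter_upwards [coeFn_boundedVec hq] with x hx
  rw [hx, Complex.ofReal_mul]

theorem memLp_top_sqrt {p : X → ℝ} (hp : MemLp p ∞ μ) :
    MemLp (fun x => Real.sqrt (p x)) ∞ μ := by
  refine memLp_top_of_bound (Real.continuous_sqrt.comp_aestronglyMeasurable hp.1)
    (Real.sqrt (eLpNormEssSup p μ).toReal) ?_
  filter_upwards [ae_le_eLpNormEssSup (f := p) (μ := μ)] with x hx
  rw [Real.norm_of_nonneg (Real.sqrt_nonneg _)]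
  refine Real.sqrt_le_sqrt ((le_abs_self _).trans ?_)
  have h := hp.2
  rw [eLpNorm_exponent_top] at h
  simpa using ENNReal.toReal_mono h.ne hx

variable [TopologicalSpace X] [BorelSpace X] [T2Space X] [LocallyCompactSpace X] [μ.Regular]
  [IsFiniteMeasure μ]

/-- An operator that commutes with enough multiplication operators acts on bounded functions as
multiplication by the image of the function `1`. -/
theorem inner_boundedVec_apply {S : Lp ℂ 2 μ →L[ℂ] Lp ℂ 2 μ}
    (hS : (commutingSubalgebra S).SeparatesPoints) {p q : X → ℝ} (hp : MemLp p ∞ μ)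
    (hq : MemLp q ∞ μ) :
    ⟪boundedVec hq, S (boundedVec hp)⟫_ℂ =
      ∫ x, ((q x * p x : ℝ) : ℂ) * S (boundedVec (memLp_top_const 1)) x ∂μ := by
  set t := S (boundedVec (memLp_top_const 1))
  set s := ContinuousLinearMap.adjoint S (boundedVec hq)
  have hti : Integrable (fun x => (q x : ℂ) * t x) μ :=
    memLp_one_iff_integrable.1 (((Lp.memLp t).mul (r := 2) hq.ofReal).mono_exponent one_le_two)
  have hsi : Integrable (fun x => star (s x)) μ :=
    ((Lp.memLp s).star).integrable one_le_two
  -- Both sides are integrals of `p` against a density; the difference `v` of the two densities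
  -- is annihilated by the commuting functions, for which the identity holds.
  have hv := ae_eq_zero_of_forall_mem_subalgebra (R := commutingSubalgebra S) (μ := μ)
    (fun u hu => hu.1) hS (v := fun x => (q x : ℂ) * t x - star (s x)) (hti.sub hsi) ?_
  · rw [← ContinuousLinearMap.adjoint_inner_left, L2.inner_def]
    refine integral_congr_ae ?_
    filter_upwards [hv, coeFn_boundedVec hp] with x h1 h2
    have h3 : star (s x) = (q x : ℂ) * t x := (sub_eq_zero.1 h1).symm
    rw [h2, RCLike.inner_apply]
    change (p x : ℂ) * star (s x) = _
    rw [h3]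
    push_cast
    ring
  · rintro u ⟨⟨C, hC⟩, hu, hSu⟩
    have hu' : MemLp u ∞ μ := memLp_top_of_bound
      u.continuous.measurable.aestronglyMeasurable C (Filter.Eventually.of_forall hC)
    have h1 : mulOp hu (boundedVec (memLp_top_const 1)) = boundedVec hu' := by
      refine Lp.ext ?_
      filter_upwards [coeFn_mulOp hu (boundedVec (memLp_top_const 1)), coeFn_boundedVec hu',
        coeFn_boundedVec (μ := μ) (X := X) (memLp_top_const 1)] with x h1 h2 h3
      rw [h1, h2, h3, Complex.ofReal_one, mul_one]
    have h2 : S (boundedVec hu') = mulOp hu t := by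
      rw [← h1]
      exact DFunLike.congr_fun hSu.eq _
    have h3 : ⟪s, boundedVec hu'⟫_ℂ = ⟪boundedVec hq, mulOp hu t⟫_ℂ := by
      rw [ContinuousLinearMap.adjoint_inner_left, h2]
    have hb : ∀ g : X → ℂ, Integrable g μ → Integrable (fun x => (u x : ℂ) * g x) μ :=
      fun g hg => hg.bdd_mul (c := C) hu.1 (Filter.Eventually.of_forall fun x => by
        simpa using hC x)
    simp only [mul_sub]
    rw [integral_sub (hb _ hti) (hb _ hsi), sub_eq_zero]
    calc ∫ x, (u x : ℂ) * ((q x : ℂ) * t x) ∂μ = ⟪boundedVec hq, mulOp hu t⟫_ℂ := by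
          rw [inner_boundedVec]
          refine integral_congr_ae ?_
          filter_upwards [coeFn_mulOp hu t] with x hx
          rw [hx]
          ring
      _ = ⟪s, boundedVec hu'⟫_ℂ := h3.symm
      _ = ∫ x, (u x : ℂ) * star (s x) ∂μ := by
          rw [L2.inner_def]
          refine integral_congr_ae ?_
          filter_upwards [coeFn_boundedVec hu'] with x hx
          rw [hx, RCLike.inner_apply]
          rfl

/-- For a contraction `S` that commutes with enough multiplication operators, both factors of
`⟨q, S p⟩` may be replaced by their geometric mean `√(qp)`, whose squared norm is `∫ qp`. -/
theorem norm_inner_boundedVec_apply_le {S : Lp ℂ 2 μ →L[ℂ] Lp ℂ 2 μ} (hS1 : ‖S‖ ≤ 1)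
    (hS : (commutingSubalgebra S).SeparatesPoints) {p q : X → ℝ} (hp : MemLp p ∞ μ)
    (hq : MemLp q ∞ μ) (hp0 : ∀ x, 0 ≤ p x) (hq0 : ∀ x, 0 ≤ q x) :
    ‖⟪boundedVec hq, S (boundedVec hp)⟫_ℂ‖ ≤ ∫ x, q x * p x ∂μ := by
  have hw := memLp_top_sqrt (hp.mul (r := ∞) hq)
  have hww : ∀ x, Real.sqrt ((q * p) x) * Real.sqrt ((q * p) x) = q x * p x := fun x =>
    Real.mul_self_sqrt (mul_nonneg (hq0 x) (hp0 x))
  have h1 : ⟪boundedVec hq, S (boundedVec hp)⟫_ℂ = ⟪boundedVec hw, S (boundedVec hw)⟫_ℂ := by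
    rw [inner_boundedVec_apply hS, inner_boundedVec_apply hS]
    simp only [hww]
  have h2 : ‖boundedVec hw‖ ^ 2 = ∫ x, q x * p x ∂μ := by
    have := inner_boundedVec_boundedVec hw hw
    simp only [hww, inner_self_eq_norm_sq_to_K] at this
    exact Complex.ofReal_injective (by rw [← this]; simp)
  calc ‖⟪boundedVec hq, S (boundedVec hp)⟫_ℂ‖
      = ‖⟪boundedVec hw, S (boundedVec hw)⟫_ℂ‖ := by rw [h1]
    _ ≤ ‖boundedVec hw‖ * ‖S (boundedVec hw)‖ := norm_inner_le_norm _ _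
    _ ≤ ‖boundedVec hw‖ * ‖boundedVec hw‖ := by
        gcongr
        simpa using S.le_of_opNorm_le hS1 (boundedVec hw)
    _ = _ := by rw [← h2, sq]

end Multiplication

/-! ### The representation by multiplication operators -/

section MulRep

variable {A : Type u} [Ring A] [StarRing A] [Algebra ℂ A]
variable {Y : Type w} [MeasurableSpace Y]

/-- Unital `*`-homomorphisms of `A` into the functions on `Y`. The abbreviation fixes the path of
instances, which matters when `A` is a `StarSubalgebra`. -/
abbrev FunctionHom (A : Type u) [Ring A] [StarRing A] [Algebra ℂ A] (Y : Type w) : Type _ :=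
  A →⋆ₐ[ℂ] (Y → ℂ)

/-- The functions `h ∈ L²` with `m(a) h ∈ L²` for all `a`. -/
def mulDomain (ν : Measure Y) (m : FunctionHom A Y) : Submodule ℂ (Lp ℂ 2 ν) where
  carrier := {h | ∀ a, MemLp (fun y => m a y * h y) 2 ν}
  add_mem' {h k} hh hk a := by
    refine ((hh a).add (hk a)).ae_eq ?_
    filter_upwards [Lp.coeFn_add h k] with y hy
    rw [hy, Pi.add_apply, Pi.add_apply, mul_add]
  zero_mem' a := by
    refine (MemLp.zero (ε := ℂ)).ae_eq ?_
    filter_upwards [Lp.coeFn_zero ℂ 2 ν] with y hy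
    rw [hy]
    simp
  smul_mem' c h hh a := by
    refine ((hh a).const_mul c).ae_eq ?_
    filter_upwards [Lp.coeFn_smul c h] with y hy
    rw [hy, Pi.smul_apply, smul_eq_mul]
    ring

variable {ν : Measure Y} {m : FunctionHom A Y}

theorem mem_mulDomain_of_memLp_top (hm : ∀ a, MemLp (m a) 2 ν) {h : Lp ℂ 2 ν}
    (hh : MemLp h ∞ ν) : h ∈ mulDomain ν m := fun a => hh.mul (hm a)

theorem mulOp_mem_mulDomain {u : Y → ℂ} (hu : MemLp u ∞ ν) {h : Lp ℂ 2 ν}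
    (hh : h ∈ mulDomain ν m) : mulOp hu h ∈ mulDomain ν m := fun a => by
  refine ((hh a).mul (r := 2) hu).ae_eq ?_
  filter_upwards [coeFn_mulOp hu h] with y hy
  rw [hy, Pi.mul_apply]
  ring

theorem dense_mulDomain (hm : ∀ a, MemLp (m a) 2 ν) :
    Dense (mulDomain ν m : Set (Lp ℂ 2 ν)) := by
  refine (Lp.simpleFunc.dense (E := ℂ) (p := 2) (μ := ν) ENNReal.ofNat_ne_top).mono fun h hh => ?_
  refine mem_mulDomain_of_memLp_top hm ?_
  exact ((Lp.simpleFunc.toSimpleFunc ⟨h, hh⟩).memLp_top ν).ae_eq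
    (Lp.simpleFunc.toSimpleFunc_eq_toFun ⟨h, hh⟩)

/-- Multiplication by `m(a)` on `mulDomain ν m`. -/
def mulDomainOp (ν : Measure Y) (m : FunctionHom A Y) (a : A) (h : mulDomain ν m) :
    mulDomain ν m :=
  ⟨(h.2 a).toLp, fun b => by
    refine (h.2 (b * a)).ae_eq ?_
    filter_upwards [(h.2 a).coeFn_toLp] with y hy
    rw [hy, map_mul, Pi.mul_apply, mul_assoc]⟩

theorem coeFn_mulDomainOp (a : A) (h : mulDomain ν m) :
    (mulDomainOp ν m a h : Lp ℂ 2 ν) =ᵐ[ν] fun y => m a y * (h : Lp ℂ 2 ν) y :=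
  (h.2 a).coeFn_toLp

/-- The `*`-representation of `A` on `L²` by the multiplication operators with the functions
`m(a)`, on the largest domain invariant under all of them. -/
def mulRep (ν : Measure Y) (m : FunctionHom A Y) (hm : ∀ a, MemLp (m a) 2 ν) :
    StarRep A (Lp ℂ 2 ν) where
  domain := mulDomain ν m
  dense_domain := dense_mulDomain hm
  op := AlgHom.ofLinearMap
    { toFun a :=
        { toFun := mulDomainOp ν m a
          map_add' h k := by
            refine Subtype.ext (Lp.ext ?_)
            filter_upwards [coeFn_mulDomainOp a (h + k), coeFn_mulDomainOp a h,
              coeFn_mulDomainOp a k, Lp.coeFn_add (h : Lp ℂ 2 ν) k,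
              Lp.coeFn_add (mulDomainOp ν m a h : Lp ℂ 2 ν) (mulDomainOp ν m a k)]
              with y h1 h2 h3 h4 h5
            rw [Submodule.coe_add] at h1
            rw [Submodule.coe_add, h1, h5, h4, Pi.add_apply, Pi.add_apply, h2, h3, mul_add]
          map_smul' c h := by
            refine Subtype.ext (Lp.ext ?_)
            filter_upwards [coeFn_mulDomainOp a (c • h), coeFn_mulDomainOp a h,
              Lp.coeFn_smul c (h : Lp ℂ 2 ν),
              Lp.coeFn_smul c (mulDomainOp ν m a h : Lp ℂ 2 ν)] with y h1 h2 h3 h4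
            rw [Submodule.coe_smul] at h1
            rw [RingHom.id_apply, Submodule.coe_smul, h1, h4, h3, Pi.smul_apply, Pi.smul_apply,
              h2, smul_eq_mul, smul_eq_mul, mul_left_comm] }
      map_add' a b := by
        refine LinearMap.ext fun h => Subtype.ext (Lp.ext ?_)
        filter_upwards [coeFn_mulDomainOp (a + b) h, coeFn_mulDomainOp a h,
          coeFn_mulDomainOp b h,
          Lp.coeFn_add (mulDomainOp ν m a h : Lp ℂ 2 ν) (mulDomainOp ν m b h)] with y h1 h2 h3 h4
        refine h1.trans (Eq.trans ?_ h4.symm)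
        rw [Pi.add_apply, h2, h3, map_add, Pi.add_apply, add_mul]
      map_smul' c a := by
        refine LinearMap.ext fun h => Subtype.ext (Lp.ext ?_)
        filter_upwards [coeFn_mulDomainOp (c • a) h, coeFn_mulDomainOp a h,
          Lp.coeFn_smul c (mulDomainOp ν m a h : Lp ℂ 2 ν)] with y h1 h2 h3
        refine h1.trans (Eq.trans ?_ h3.symm)
        rw [Pi.smul_apply, h2, map_smul, Pi.smul_apply, smul_eq_mul, smul_eq_mul, mul_assoc] }
    (by
      refine LinearMap.ext fun h => Subtype.ext (Lp.ext ?_)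
      filter_upwards [coeFn_mulDomainOp 1 h] with y h1
      refine h1.trans ?_
      rw [map_one, Pi.one_apply, one_mul]
      rfl)
    (by
      intro a b
      refine LinearMap.ext fun h => Subtype.ext (Lp.ext ?_)
      filter_upwards [coeFn_mulDomainOp (a * b) h, coeFn_mulDomainOp b h,
        coeFn_mulDomainOp a (mulDomainOp ν m b h)] with y h1 h2 h3
      refine h1.trans (Eq.trans ?_ h3.symm)
      rw [h2, map_mul, Pi.mul_apply, mul_assoc])
  inner_op a h k := by
    change ⟪(mulDomainOp ν m a h : Lp ℂ 2 ν), (k : Lp ℂ 2 ν)⟫_ℂ =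
      ⟪(h : Lp ℂ 2 ν), (mulDomainOp ν m (star a) k : Lp ℂ 2 ν)⟫_ℂ
    rw [L2.inner_def, L2.inner_def]
    refine integral_congr_ae ?_
    filter_upwards [coeFn_mulDomainOp a h, coeFn_mulDomainOp (star a) k] with y h1 h2
    rw [h1, h2, RCLike.inner_apply, RCLike.inner_apply, map_star, map_mul, Pi.star_apply,
      RCLike.star_def]
    ring

theorem coeFn_mulRep_op (hm : ∀ a, MemLp (m a) 2 ν) (a : A) (h : (mulRep ν m hm).domain) :
    ((mulRep ν m hm).op a h : Lp ℂ 2 ν) =ᵐ[ν] fun y => m a y * (h : Lp ℂ 2 ν) y :=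
  coeFn_mulDomainOp a h

theorem inner_mulOp_ofReal {u : Y → ℝ} (hu : MemLp (fun y => (u y : ℂ)) ∞ ν)
    (h k : Lp ℂ 2 ν) : ⟪mulOp hu h, k⟫_ℂ = ⟪h, mulOp hu k⟫_ℂ := by
  rw [L2.inner_def, L2.inner_def]
  refine integral_congr_ae ?_
  filter_upwards [coeFn_mulOp hu h, coeFn_mulOp hu k] with y h1 h2
  rw [h1, h2, RCLike.inner_apply, RCLike.inner_apply, map_mul, Complex.conj_ofReal]
  ring

/-- An operator in the weak commutant of the multiplication representation commutes with the
bounded operators of multiplication by `1 / m(c)`, for hermitian `c`: on the domain, `m(c)` can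
be moved through `S`, and multiplication by `1 / m(c)` maps the domain into itself. -/
theorem commute_mulOp_of_weakCommutant (hm : ∀ a, MemLp (m a) 2 ν)
    {S : Lp ℂ 2 ν →L[ℂ] Lp ℂ 2 ν}
    (hS : ∀ (a : A) (h k : (mulRep ν m hm).domain),
      ⟪S ((mulRep ν m hm).op (star a) h : Lp ℂ 2 ν), (k : Lp ℂ 2 ν)⟫_ℂ =
        ⟪S (h : Lp ℂ 2 ν), ((mulRep ν m hm).op a k : Lp ℂ 2 ν)⟫_ℂ)
    {c : A} (hc : star c = c) {u : Y → ℝ} (hu : MemLp (fun y => (u y : ℂ)) ∞ ν)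
    (huc : ∀ y, m c y * u y = 1) : Commute S (mulOp hu) := by
  have hop : ∀ h (hh : h ∈ (mulRep ν m hm).domain),
      ((mulRep ν m hm).op c ⟨mulOp hu h, mulOp_mem_mulDomain hu hh⟩ : Lp ℂ 2 ν) = h := by
    intro h hh
    refine Lp.ext ?_
    filter_upwards [coeFn_mulRep_op hm c ⟨mulOp hu h, mulOp_mem_mulDomain hu hh⟩,
      coeFn_mulOp hu h] with y h1 h2
    rw [h1, h2, ← mul_assoc, huc, one_mul]
  refine ContinuousLinearMap.ext fun h => ?_
  refine congrFun (Continuous.ext_on (dense_mulDomain hm) (f := fun h => S (mulOp hu h))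
    (g := fun h => mulOp hu (S h)) (by fun_prop) (by fun_prop) fun h hh => ?_) h
  refine (dense_mulDomain hm).eq_of_inner_left ℂ fun k hk => ?_
  have h1 := hS c ⟨mulOp hu h, mulOp_mem_mulDomain hu hh⟩
    ⟨mulOp hu k, mulOp_mem_mulDomain hu hk⟩
  rw [hc, hop h hh, hop k hk] at h1
  exact h1.symm.trans (inner_mulOp_ofReal hu _ _).symm

end MulRep

/-! ### Function algebras -/

section FunctionAlgebra

variable {X : Type u} [TopologicalSpace X]

/-- The elements of an algebra of continuous functions on `X`, pulled back along a map to `X`. -/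
def pullbackHom {Y : Type w} (A : StarSubalgebra ℂ C(X, ℂ)) (e : Y → X) : FunctionHom A Y where
  toFun a y := (a : C(X, ℂ)) (e y)
  map_one' := rfl
  map_mul' _ _ := rfl
  map_zero' := rfl
  map_add' _ _ := rfl
  commutes' _ := rfl
  map_star' _ := rfl

variable [MeasurableSpace X] {A : StarSubalgebra ℂ C(X, ℂ)}
  {μ : Measure X}

theorem isFiniteMeasure_of_integrable (hA : ∀ a ∈ A, Integrable (fun x => a x) μ) :
    IsFiniteMeasure μ := by
  have h : Integrable (fun _ : X => (1 : ℂ)) μ := hA 1 (one_mem A)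
  exact (integrable_const_iff_isFiniteMeasure one_ne_zero).1 h

variable {Y : Type w} [MeasurableSpace Y] {ν : Measure Y} {e : Y ≃ᵐ X}

theorem memLp_pullbackHom (hA : ∀ a ∈ A, Integrable (fun x => a x) μ)
    (he : MeasurePreserving e ν μ) (a : A) : MemLp (pullbackHom A e a) 2 ν := by
  have h : MemLp (fun x => (a : C(X, ℂ)) x) 2 μ := by
    refine (memLp_two_iff_integrable_sq_norm (hA _ a.2).1).2 ?_
    refine (hA _ (star a * a).2).norm.congr (Filter.Eventually.of_forall fun x => ?_)
    change ‖star ((a : C(X, ℂ)) x) * (a : C(X, ℂ)) x‖ = _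
    rw [norm_mul, norm_star]
    exact (sq _).symm
  exact h.comp_measurePreserving he

/-- The class of `√η` as a vector in the domain of the multiplication representation. -/
def sqrtVec [IsFiniteMeasure ν] (hA : ∀ a ∈ A, Integrable (fun x => a x) μ)
    (he : MeasurePreserving e ν μ) {η : X → ℝ} (hη : MemLp η ∞ μ) :
    (mulRep ν (pullbackHom A e) (memLp_pullbackHom hA he)).domain :=
  ⟨boundedVec (memLp_top_sqrt (hη.comp_measurePreserving he)),
    mem_mulDomain_of_memLp_top (memLp_pullbackHom hA he)
      ((memLp_top_sqrt (hη.comp_measurePreserving he)).ofReal.ae_eq (coeFn_boundedVec _).symm)⟩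

theorem integralFunctional_eq_inner [BorelSpace X] [IsFiniteMeasure ν]
    (hA : ∀ a ∈ A, Integrable (fun x => a x) μ)
    (he : MeasurePreserving e ν μ) {η : X → ℝ} (hη : MemLp η ∞ μ) (hη0 : 0 ≤ᵐ[μ] η) (a : A) :
    integralFunctional A μ hA η hη hη0 a =
      ⟪(sqrtVec hA he hη : Lp ℂ 2 ν),
        ((mulRep ν (pullbackHom A e) (memLp_pullbackHom hA he)).op a
          (sqrtVec hA he hη) : Lp ℂ 2 ν)⟫_ℂ := by
  have h1 : integralFunctional A μ hA η hη hη0 a =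
      ∫ y, (a : C(X, ℂ)) (e y) * (η (e y) : ℂ) ∂ν :=
    (he.integral_comp' (fun x => (a : C(X, ℂ)) x * (η x : ℂ))).symm
  have h2 : ∀ᵐ y ∂ν, 0 ≤ η (e y) := he.quasiMeasurePreserving.ae hη0
  have hs := memLp_top_sqrt (hη.comp_measurePreserving he)
  rw [h1]
  refine Eq.trans ?_ (inner_boundedVec hs _).symm
  refine integral_congr_ae ?_
  filter_upwards [h2, coeFn_boundedVec hs,
    coeFn_mulRep_op (memLp_pullbackHom hA he) a (sqrtVec hA he hη)] with y h3 h4 h5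
  have h6 : (sqrtVec hA he hη : Lp ℂ 2 ν) y = (Real.sqrt (η (e y)) : ℂ) := h4
  have h7 : (Real.sqrt (η (e y)) : ℂ) * Real.sqrt (η (e y)) = η (e y) := by
    rw [← Complex.ofReal_mul, Real.mul_self_sqrt h3]
  rw [h5, h6, ← h7]
  change _ = (Real.sqrt (η (e y)) : ℂ) * ((a : C(X, ℂ)) (e y) * _)
  ring

theorem inner_sqrtVec_sqrtVec [IsFiniteMeasure ν] (hA : ∀ a ∈ A, Integrable (fun x => a x) μ)
    (he : MeasurePreserving e ν μ) {η ξ : X → ℝ} (hη : MemLp η ∞ μ) (hξ : MemLp ξ ∞ μ) :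
    ⟪(sqrtVec hA he hξ : Lp ℂ 2 ν), (sqrtVec hA he hη : Lp ℂ 2 ν)⟫_ℂ =
      (∫ x, Real.sqrt (η x) * Real.sqrt (ξ x) ∂μ : ℝ) := by
  rw [← he.integral_comp' (fun x => Real.sqrt (η x) * Real.sqrt (ξ x))]
  refine (inner_boundedVec_boundedVec (memLp_top_sqrt (hξ.comp_measurePreserving he))
    (memLp_top_sqrt (hη.comp_measurePreserving he))).trans ?_
  congr 1
  exact integral_congr_ae (Filter.Eventually.of_forall fun y => mul_comm _ _)

/-- The weak commutant of the multiplication representation of a point-separating algebra `A`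
commutes with multiplication by the functions `1 / (1 + |a|²)`, which separate the points too. -/
theorem separatesPoints_commutingSubalgebra [BorelSpace X] (hsep : A.toSubalgebra.SeparatesPoints)
    (hA : ∀ a ∈ A, Integrable (fun x => a x) μ)
    {S : Lp ℂ 2 μ →L[ℂ] Lp ℂ 2 μ}
    (he : MeasurePreserving (MeasurableEquiv.refl X) μ μ)
    (hS : ∀ (a : A) (h k : (mulRep μ _ (memLp_pullbackHom hA he)).domain),
      ⟪S ((mulRep μ _ (memLp_pullbackHom hA he)).op (star a) h : Lp ℂ 2 μ), (k : Lp ℂ 2 μ)⟫_ℂ =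
        ⟪S (h : Lp ℂ 2 μ), ((mulRep μ _ (memLp_pullbackHom hA he)).op a k : Lp ℂ 2 μ)⟫_ℂ) :
    (commutingSubalgebra S).SeparatesPoints := by
  intro x y hxy
  obtain ⟨_, ⟨a0, ha0, rfl⟩, hne⟩ := hsep hxy
  -- normalize the separating function to vanish at `x`
  let a : A := ⟨a0, ha0⟩ - algebraMap ℂ A (a0 x)
  have ha : ∀ z, (a : C(X, ℂ)) z = a0 z - a0 x := fun z => rfl
  let u : C(X, ℝ) := ⟨fun z => (1 + ‖(a : C(X, ℂ)) z‖ ^ 2)⁻¹, by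
    refine Continuous.inv₀ (by fun_prop) fun z => ?_
    positivity⟩
  have hu1 : ∀ z, |u z| ≤ 1 := fun z => by
    change |(1 + ‖(a : C(X, ℂ)) z‖ ^ 2)⁻¹| ≤ 1
    rw [abs_of_nonneg (by positivity)]
    exact inv_le_one_of_one_le₀ (by linarith [sq_nonneg ‖(a : C(X, ℂ)) z‖])
  refine ⟨u, ⟨u, ⟨⟨1, hu1⟩, memLp_top_ofReal_of_bound u hu1, ?_⟩, rfl⟩, ?_⟩
  · refine commute_mulOp_of_weakCommutant (memLp_pullbackHom hA he) hS
      (c := 1 + star a * a) (by rw [star_add, star_one, star_mul, star_star]) _ fun z => ?_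
    change (1 + star ((a : C(X, ℂ)) z) * (a : C(X, ℂ)) z) *
      (((1 + ‖(a : C(X, ℂ)) z‖ ^ 2)⁻¹ : ℝ) : ℂ) = 1
    rw [RCLike.star_def, Complex.conj_mul', Complex.ofReal_inv]
    have : (1 : ℂ) + (‖(a : C(X, ℂ)) z‖ : ℂ) ^ 2 = ((1 + ‖(a : C(X, ℂ)) z‖ ^ 2 : ℝ) : ℂ) := by
      push_cast
      rfl
    rw [this]
    refine mul_inv_cancel₀ (Complex.ofReal_ne_zero.2 ?_)
    positivity
  · change (1 + ‖(a : C(X, ℂ)) x‖ ^ 2)⁻¹ ≠ (1 + ‖(a : C(X, ℂ)) y‖ ^ 2)⁻¹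
    rw [ha, ha, sub_self, norm_zero, Ne, inv_inj]
    have : 0 < ‖a0 y - a0 x‖ := norm_pos_iff.2 (sub_ne_zero.2 fun h => hne h.symm)
    have : 0 < ‖a0 y - a0 x‖ ^ 2 := by positivity
    intro h
    linarith

theorem norm_inner_le_integral_sqrt {X : Type u} [TopologicalSpace X] [T2Space X]
    [LocallyCompactSpace X] [MeasurableSpace X] [BorelSpace X]
    {A : StarSubalgebra ℂ C(X, ℂ)} (hsep : A.toSubalgebra.SeparatesPoints)
    {μ : Measure X} [μ.Regular] (hA : ∀ a ∈ A, Integrable (fun x => a x) μ)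
    {η ξ : X → ℝ} (hη : MemLp η ∞ μ) (hξ : MemLp ξ ∞ μ) (hη0 : 0 ≤ᵐ[μ] η) (hξ0 : 0 ≤ᵐ[μ] ξ)
    (hessη : (gnsRep (integralFunctional A μ hA η hη hη0)).IsEssentiallySelfAdjoint)
    (hessξ : (gnsRep (integralFunctional A μ hA ξ hξ hξ0)).IsEssentiallySelfAdjoint)
    {H : Type w} [NormedAddCommGroup H] [InnerProductSpace ℂ H] [CompleteSpace H]
    (π : StarRep A H) (φ ψ : π.domain)
    (hφ : ∀ a, integralFunctional A μ hA η hη hη0 a = ⟪(φ : H), (π.op a φ : H)⟫_ℂ)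
    (hψ : ∀ a, integralFunctional A μ hA ξ hξ hξ0 a = ⟪(ψ : H), (π.op a ψ : H)⟫_ℂ) :
    ‖⟪(ψ : H), (φ : H)⟫_ℂ‖ ≤ ∫ x, Real.sqrt (η x) * Real.sqrt (ξ x) ∂μ := by
  have := isFiniteMeasure_of_integrable hA
  have he : MeasurePreserving (MeasurableEquiv.refl X) μ μ := MeasurePreserving.id μ
  obtain ⟨S, hS1, hS, hSin⟩ := exists_contraction_weakCommutant hessη hessξ π φ ψ hφ hψ
    (mulRep μ _ (memLp_pullbackHom hA he)) (sqrtVec hA he hη) (sqrtVec hA he hξ)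
    (integralFunctional_eq_inner hA he hη hη0) (integralFunctional_eq_inner hA he hξ hξ0)
  rw [← hSin]
  refine (norm_inner_boundedVec_apply_le hS1 (separatesPoints_commutingSubalgebra hsep hA he hS)
    (memLp_top_sqrt (hη.comp_measurePreserving he)) (memLp_top_sqrt (hξ.comp_measurePreserving he))
    (fun _ => Real.sqrt_nonneg _) (fun _ => Real.sqrt_nonneg _)).trans_eq ?_
  exact integral_congr_ae (Filter.Eventually.of_forall fun y => mul_comm _ _)

end FunctionAlgebra

end UnboundedRep

end

theorem mainTheorem4 {X : Type u} [TopologicalSpace X] [T2Space X] [LocallyCompactSpace X]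
    [MeasurableSpace X] [BorelSpace X]
    (A : StarSubalgebra ℂ C(X, ℂ)) (hsep : A.toSubalgebra.SeparatesPoints)
    (μ : MeasureTheory.Measure X) [μ.Regular]
    (hA : ∀ a ∈ A, MeasureTheory.Integrable (fun x => a x) μ)
    (η ξ : X → ℝ) (hη : MeasureTheory.MemLp η ⊤ μ) (hξ : MeasureTheory.MemLp ξ ⊤ μ)
    (hη0 : ∀ᵐ x ∂μ, 0 ≤ η x) (hξ0 : ∀ᵐ x ∂μ, 0 ≤ ξ x)
    (hessη : (UnboundedRep.gnsRep
      (UnboundedRep.integralFunctional A μ hA η hη hη0)).IsEssentiallySelfAdjoint)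
    (hessξ : (UnboundedRep.gnsRep
      (UnboundedRep.integralFunctional A μ hA ξ hξ hξ0)).IsEssentiallySelfAdjoint) :
    IsLUB
      (UnboundedRep.transitionValues.{u, max u v}
        (UnboundedRep.integralFunctional A μ hA η hη hη0)
        (UnboundedRep.integralFunctional A μ hA ξ hξ hξ0))
      (UnboundedRep.transitionProb.{u, max u v}
        (UnboundedRep.integralFunctional A μ hA η hη hη0)
        (UnboundedRep.integralFunctional A μ hA ξ hξ hξ0)) ∧
    UnboundedRep.transitionProb.{u, max u v}
        (UnboundedRep.integralFunctional A μ hA η hη hη0)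
        (UnboundedRep.integralFunctional A μ hA ξ hξ hξ0) =
      (∫ x, Real.sqrt (η x) * Real.sqrt (ξ x) ∂μ) ^ 2 := by
  have := UnboundedRep.isFiniteMeasure_of_integrable hA
  -- The multiplication representation is realized on a copy of `X` in the universe of the
  -- admissible Hilbert spaces.
  let e : ULift.{v} X ≃ᵐ X := MeasurableEquiv.ulift
  let ν : Measure (ULift.{v} X) := μ.map e.symm
  have he : MeasurePreserving e ν μ := MeasurableEquiv.measurePreserving_symm μ e.symm
  have : IsFiniteMeasure ν := Measure.isFiniteMeasure_map μ e.symm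
  have hI : 0 ≤ ∫ x, Real.sqrt (η x) * Real.sqrt (ξ x) ∂μ :=
    integral_nonneg fun x => mul_nonneg (Real.sqrt_nonneg _) (Real.sqrt_nonneg _)
  have hgreatest : IsGreatest
      (UnboundedRep.transitionValues.{u, max u v}
        (UnboundedRep.integralFunctional A μ hA η hη hη0)
        (UnboundedRep.integralFunctional A μ hA ξ hξ hξ0))
      ((∫ x, Real.sqrt (η x) * Real.sqrt (ξ x) ∂μ) ^ 2) := by
    refine ⟨⟨Lp ℂ 2 ν, inferInstance, inferInstance, inferInstance,
      UnboundedRep.mulRep ν _ (UnboundedRep.memLp_pullbackHom hA he),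
      UnboundedRep.sqrtVec hA he hη, UnboundedRep.sqrtVec hA he hξ,
      UnboundedRep.integralFunctional_eq_inner hA he hη hη0,
      UnboundedRep.integralFunctional_eq_inner hA he hξ hξ0, ?_⟩, ?_⟩
    · rw [UnboundedRep.inner_sqrtVec_sqrtVec hA he hη hξ, Complex.norm_real,
        Real.norm_of_nonneg hI]
    · rintro _ ⟨H, _, _, _, π, φ, ψ, hφ, hψ, rfl⟩
      exact pow_le_pow_left₀ (norm_nonneg _) (UnboundedRep.norm_inner_le_integral_sqrt hsep hA
        hη hξ hη0 hξ0 hessη hessξ π φ ψ hφ hψ) 2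
  have heq := hgreatest.isLUB.csSup_eq ⟨_, hgreatest.1⟩
  refine ⟨?_, heq⟩
  rw [UnboundedRep.transitionProb, heq]
  exact hgreatest.isLUB
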